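/- Let $\alpha>0$ be a constant and let $t\in\mathbb N$. Then there are constants $K=K(\alpha,t)>0$ and $c=c(\alpha,t)>0$ such that the following holds for every $s\in\mathbb N$ with $2\le s\le t$. Let $G$ be a graph on $n$ vertices which is $K_{s,t}$-free (it contains no copy of the complete bipartite graph $K_{s,t}$ as a, not necessarily induced, subgraph) and has at least $\alpha n^{2-1/s}$ edges, and let $\frac{K}{n^{1-1/s}}\le p\le 1$. Let $G_p$ be the random subgraph of $G$ obtained by retaining each edge of $G$ independently with probability $p$. Then, with high probability, $G_p$ contains a cycle of length at least $cn$. Here "with high probability" means with probability tending to $1$ as $n\to\infty$, uniformly in $s$, $G$ and $p$: for every $\eta>0$ there is $n_0=n_0(\alpha,t,\eta)$ such that for all $n\ge n_0$ and all $s$, $G$ and $p$ as above, the probability is at least $1-\eta$. -/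

import Mathlib

open MeasureTheory ProbabilityTheory

/-- The law of the random subgraph `G_p` of a host graph `G`: every edge of `G` is retained
independently with probability `p`, and no other edge is present. -/
noncomputable def SimpleGraph.percolation {V : Type*} (G : SimpleGraph V) (p : unitInterval) :
    Measure (SimpleGraph V) :=
  (setBernoulli G.edgeSet p).comap SimpleGraph.edgeSet

instance SimpleGraph.isProbabilityMeasure_percolation {V : Type*} [Countable V]
    (G : SimpleGraph V) (p : unitInterval) : IsProbabilityMeasure (G.percolation p) := by
  refine SimpleGraph.measurableEmbedding_edgeSet.isProbabilityMeasure_comap ?_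
  filter_upwards [setBernoulli_ae_subset] with s hs
  refine ⟨SimpleGraph.fromEdgeSet s, ?_⟩
  rw [SimpleGraph.edgeSet_fromEdgeSet, sdiff_eq_left, Set.disjoint_left]
  exact fun e he hd => G.not_isDiag_of_mem_edgeSet (hs he) hd

/-- Each spanning subgraph `H ≤ G` occurs with probability `p ^ e(H) * (1 - p) ^ (e(G) - e(H))`. -/
theorem SimpleGraph.percolation_real_singleton {V : Type*} [Finite V] (G H : SimpleGraph V)
    (hH : H ≤ G) (p : unitInterval) :
    (G.percolation p).real {H} =
      (p : ℝ) ^ H.edgeSet.ncard * (1 - p : ℝ) ^ (G.edgeSet \ H.edgeSet).ncard := by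
  rw [← setBernoulli_real_singleton p (SimpleGraph.edgeSet_mono hH) (Set.toFinite _),
    SimpleGraph.percolation, measureReal_def, measureReal_def,
    SimpleGraph.measurableEmbedding_edgeSet.comap_apply, Set.image_singleton]

/-- The graph `H` contains a cycle with at least `ℓ` edges. -/
def SimpleGraph.HasCycleOfLengthAtLeast {V : Type*} (H : SimpleGraph V) (ℓ : ℝ) : Prop :=
  ∃ (v : V) (w : H.Walk v v), w.IsCycle ∧ ℓ ≤ (w.length : ℝ)

/-! Depth-first search shows that if all vertex sets of size between `k / 2` and `k` have at least
`m` outside neighbours, there is a cycle longer than `m` (`LocallyExpands.exists_isCycle`). A path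
grows into a set attached to its end; once a piece of that set of size at most `k` is closed off,
its neighbours all lie on the path, which then closes up through the attached set.

In `G`, some `U` has minimum degree of order `n^(1-1/s)`. By Kővári–Sós–Turán, a set `M` of at most
`γ ^ 2 * n` vertices spans `O(γ^3 n^(2-1/s))` edges, while a subset `W` of size at least `γ ^ 2 * n
/ 8` has degree sum of order `γ^2 n^(2-1/s)`. For small `γ`, many edges thus join `W` to `U \ M`.
All of them vanish in `G_p` with probability at most `e^(-3n)`, which beats the at most `4^n` pairs
`(W, M)`. -/

namespace SimpleGraph

variable {V : Type*} {G : SimpleGraph V}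

/-! ### Closing paths into cycles -/

/-- A nonempty set of vertices of a path is contained in the suffix starting at one of them. -/
theorem Walk.IsPath.exists_suffix_containing {a v : V} {p : G.Walk a v} (hp : p.IsPath)
    {N : Set V} (hN : ∀ x ∈ N, x ∈ p.support) (hne : N.Nonempty) :
    ∃ x ∈ N, ∃ q : G.Walk x v, q.IsPath ∧ (∀ y ∈ q.support, y ∈ p.support) ∧
      ∀ y ∈ N, y ∈ q.support := by
  induction p with
  | nil =>
    obtain ⟨x, hx⟩ := hne
    have := hN x hx
    simp only [Walk.support_nil, List.mem_singleton] at this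
    subst this
    exact ⟨x, hx, Walk.nil, by simp, by simp, hN⟩
  | @cons u w v h p ih =>
    by_cases hu : u ∈ N
    · exact ⟨u, hu, Walk.cons h p, hp, fun _ hy => hy, hN⟩
    · have hN' : ∀ x ∈ N, x ∈ p.support := by
        intro x hx
        have := hN x hx
        rw [Walk.support_cons, List.mem_cons] at this
        rcases this with rfl | h
        · exact absurd hx hu
        · exact h
      obtain ⟨x, hx, q, hq, hs, hc⟩ := ih hp.of_cons hN'
      exact ⟨x, hx, q, hq, fun y hy => by simp [hs y hy], hc⟩

/-- A path `p` ending at `v`, together with a set `C` off the path that is linked to `v`, closes up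
to a cycle that is longer than the number of path vertices adjacent to `C`. -/
theorem exists_isCycle_of_path_neighbors {a v : V} {p : G.Walk a v}
    (hp : p.IsPath) {C : Finset V} (hC : ∀ x ∈ C, x ∉ p.support)
    (hreach : ∀ x ∈ C, ∃ q : G.Walk x v, ∀ y ∈ q.support, y ∈ C ∨ y = v)
    {N : Finset V} (hN : ∀ y ∈ N, y ∈ p.support ∧ ∃ w ∈ C, G.Adj w y) (h2 : 2 ≤ N.card) :
    ∃ (u : V) (c : G.Walk u u), c.IsCycle ∧ N.card + 1 ≤ c.length := by
  classical
  obtain ⟨x, hx, q, hq, hqs, hNq⟩ := hp.exists_suffix_containing (N := (N : Set V))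
    (fun y hy => (hN y hy).1) (Finset.card_pos.1 (by omega))
  have hlen : N.card ≤ q.length + 1 := by
    rw [← Walk.length_support, ← List.toFinset_card_of_nodup hq.support_nodup]
    exact Finset.card_le_card fun y hy => List.mem_toFinset.2 (hNq y hy)
  obtain ⟨w, hw, hadj⟩ := (hN x hx).2
  obtain ⟨r₀, hr₀⟩ := hreach w hw
  obtain ⟨r, hr, hrs⟩ : ∃ r : G.Walk w v, r.IsPath ∧ ∀ y ∈ r.support, y ∈ C ∨ y = v :=
    ⟨r₀.bypass, r₀.bypass_isPath, fun y hy => hr₀ y (r₀.support_bypass_subset_support hy)⟩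
  have hwv : w ≠ v := by
    rintro rfl
    exact hC w hw p.end_mem_support
  have hxv : x ≠ v := by
    rintro rfl
    have : q = Walk.nil := by simpa using hq
    subst this
    simp only [Walk.length_nil] at hlen
    omega
  have hpath : (q.append r.reverse).IsPath := by
    rw [Walk.isPath_def, Walk.support_append, List.nodup_append]
    have hrr := hr.reverse.support_nodup
    rw [← Walk.cons_tail_support] at hrr
    refine ⟨hq.support_nodup, (List.nodup_cons.1 hrr).2, ?_⟩
    rintro y hy z hz rfl
    have hzr : y ∈ r.support := by simpa using List.mem_of_mem_tail hz
    rcases hrs y hzr with h | rfl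
    · exact hC y h (hqs y hy)
    · exact (List.nodup_cons.1 hrr).1 hz
  have hedge : s(w, x) ∉ (q.append r.reverse).edges := by
    rw [Walk.edges_append, List.mem_append]
    rintro (h | h)
    · exact hC w hw (hqs w (q.fst_mem_support_of_mem_edges h))
    · have : x ∈ r.support := by
        simpa using r.reverse.snd_mem_support_of_mem_edges h
      rcases hrs x this with h | h
      · exact hC x h (hN x hx).1
      · exact hxv h
  -- The cycle takes the edge `w x`, the suffix from `x` to `v` (at least `N.card - 1` edges), and a
  -- nontrivial return to `w` through `C`.
  refine ⟨w, Walk.cons hadj (q.append r.reverse), (Walk.cons_isCycle_iff _ _).2 ⟨hpath, hedge⟩, ?_⟩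
  have : r.length ≠ 0 := fun h => hwv (Walk.eq_of_length_eq_zero h)
  simp only [Walk.length_cons, Walk.length_append, Walk.length_reverse]
  omega

/-- Every large set `C` has a large subset `W` without edges to `C \ W` that is either of size at
most `k` or connected. -/
theorem exists_closed_small_or_connected (G : SimpleGraph V) {C : Finset V} {k : ℕ}
    (hk : k ≤ C.card) :
    ∃ W ⊆ C, k ≤ 2 * W.card ∧ (∀ x ∈ W, ∀ y ∈ C, G.Adj x y → y ∈ W) ∧
      (W.card ≤ k ∨ (k < W.card ∧
        ∀ u ∈ W, ∀ x ∈ W, ∃ q : G.Walk x u, ∀ y ∈ q.support, y ∈ W)) := by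
  classical
  set F := C.powerset.filter fun W => k ≤ 2 * W.card ∧ ∀ x ∈ W, ∀ y ∈ C, G.Adj x y → y ∈ W with hF
  -- In a smallest such `W`, a proper component and its complement would each have fewer than `k /
  -- 2` vertices, forcing `W.card < k`.
  obtain ⟨W, hWF, hmin⟩ := F.exists_min_image Finset.card
    ⟨C, by simp only [hF, Finset.mem_filter, Finset.mem_powerset]
           exact ⟨subset_rfl, by omega, fun _ _ y hy _ => hy⟩⟩
  simp only [hF, Finset.mem_filter, Finset.mem_powerset] at hWF hmin
  obtain ⟨hWC, hkW, hcl⟩ := hWF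
  refine ⟨W, hWC, hkW, hcl, ?_⟩
  by_cases hle : W.card ≤ k
  · exact Or.inl hle
  refine Or.inr ⟨by omega, fun u hu x hx => ?_⟩
  set R := W.filter fun x => ∃ q : G.Walk x u, ∀ y ∈ q.support, y ∈ W with hR
  have hRcl : ∀ x ∈ W, ∀ y ∈ W, G.Adj x y → x ∈ R → y ∈ R := by
    intro x _ y hy h hxR
    obtain ⟨q, hq⟩ := (Finset.mem_filter.1 hxR).2
    refine Finset.mem_filter.2 ⟨hy, Walk.cons h.symm q, fun z hz => ?_⟩
    rw [Walk.support_cons, List.mem_cons] at hz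
    rcases hz with rfl | hz
    exacts [hy, hq z hz]
  have huR : u ∈ R := Finset.mem_filter.2 ⟨hu, Walk.nil, by simpa using hu⟩
  by_contra hxn
  have hxR : x ∉ R := fun h => hxn (Finset.mem_filter.1 h).2
  have hRW : R ⊆ W := Finset.filter_subset _ _
  have hcard : (W \ R).card + R.card = W.card := Finset.card_sdiff_add_card_eq_card hRW
  have h1 : 0 < R.card := Finset.card_pos.2 ⟨u, huR⟩
  have h2 : 0 < (W \ R).card := Finset.card_pos.2 ⟨x, by simp [hx, hxR]⟩
  have h3 : 2 * R.card < k := by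
    by_contra hcon
    have := hmin R ⟨hRW.trans hWC, by omega, fun x hx y hy h =>
      hRcl x (hRW hx) y (hcl x (hRW hx) y hy h) h hx⟩
    omega
  have h4 : 2 * (W \ R).card < k := by
    by_contra hcon
    have := hmin (W \ R) ⟨Finset.sdiff_subset.trans hWC, by omega, fun x hx y hy h => by
      rw [Finset.mem_sdiff] at hx ⊢
      have hyW := hcl x hx.1 y hy h
      exact ⟨hyW, fun hyR => hx.2 (hRcl y hyW x hx.1 h.symm hyR)⟩⟩
    omega
  omega

/-! ### Long cycles from local expansion -/

section Expansion

variable [Fintype V] {U : Finset V} {k m : ℕ}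

open Classical in
/-- Every subset of `U` of size between `k / 2` and `k` has at least `m` outside neighbours. -/
def LocallyExpands (G : SimpleGraph V) (U : Finset V) (k m : ℕ) : Prop :=
  ∀ W ⊆ U, k ≤ 2 * W.card → W.card ≤ k →
    m ≤ (Finset.univ.filter fun y => y ∉ W ∧ ∃ w ∈ W, G.Adj w y).card

theorem LocallyExpands.exists_isCycle_of_path (hexp : G.LocallyExpands U k m) (hk : 1 ≤ k)
    (hm : 2 ≤ m) {a v : V} (p : G.Walk a v) (hp : p.IsPath) (C : Finset V) (hCU : C ⊆ U)
    (hkC : k ≤ C.card) (hC : ∀ x ∈ C, x ∉ p.support)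
    (hcl : ∀ x ∈ C, ∀ y, G.Adj x y → y ∈ C ∨ y ∈ p.support)
    (hreach : ∀ x ∈ C, ∃ q : G.Walk x v, ∀ y ∈ q.support, y ∈ C ∨ y = v) :
    ∃ (u : V) (c : G.Walk u u), c.IsCycle ∧ m + 1 ≤ c.length := by
  classical
  induction hN : C.card using Nat.strong_induction_on generalizing v C with
  | _ N ih =>
    obtain ⟨W, hWC, hkW, hWcl, hW⟩ := G.exists_closed_small_or_connected hkC
    rcases hW with hW | ⟨hW, hconn⟩
    · have hb := hexp W (hWC.trans hCU) hkW hW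
      have := exists_isCycle_of_path_neighbors hp hC hreach
        (N := Finset.univ.filter fun y => y ∉ W ∧ ∃ w ∈ W, G.Adj w y) ?_
        (hm.trans (by convert hb))
      · obtain ⟨u, c, hc, hl⟩ := this
        exact ⟨u, c, hc, le_trans (Nat.succ_le_succ (by convert hb)) hl⟩
      · intro y hy
        simp only [Finset.mem_filter, Finset.mem_univ, true_and] at hy
        obtain ⟨hyW, w, hw, h⟩ := hy
        refine ⟨(hcl w (hWC hw) y h).resolve_left fun hyC => hyW (hWcl w hw y hyC h),
          w, hWC hw, h⟩
    · obtain ⟨x, hx⟩ : W.Nonempty := Finset.card_pos.1 (by omega)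
      obtain ⟨q, hq⟩ := hreach x (hWC hx)
      have hvW : v ∉ W := fun h => hC v (hWC h) p.end_mem_support
      -- As `W` is closed in `C`, a walk to `v` can leave `W` only by stepping onto `v`. Hence `v`
      -- has a neighbour in `W`, by which the path is extended.
      obtain ⟨d, hd, hd1, hd2⟩ := q.exists_boundary_dart (W : Set V) hx hvW
      have hdv : d.snd = v := by
        refine (hq _ (q.dart_snd_mem_support_of_mem_darts hd)).resolve_left fun h => hd2 ?_
        exact hWcl _ hd1 _ h d.adj
      have hadj : G.Adj v d.fst := hdv ▸ d.adj.symm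
      have hu : d.fst ∈ W := hd1
      generalize d.fst = u at hadj hu
      have hcard := Finset.card_erase_of_mem hu
      have hlt : W.card ≤ C.card := Finset.card_le_card hWC
      refine ih (W.erase u).card (by omega) (p.concat hadj) (hp.concat (hC u (hWC hu)) hadj)
        (W.erase u) ((W.erase_subset u).trans (hWC.trans hCU)) (by omega) ?_ ?_ ?_ rfl
      · intro y hy
        rw [Finset.mem_erase] at hy
        rw [Walk.support_concat]
        simp [hy.1, hC y (hWC hy.2)]
      · intro y hy z hz
        rw [Finset.mem_erase] at hy
        rw [Walk.support_concat, Finset.mem_erase]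
        rcases hcl y (hWC hy.2) z hz with h | h
        · by_cases hzu : z = u
          · simp [hzu]
          · exact Or.inl ⟨hzu, hWcl y hy.2 z h hz⟩
        · right
          simp [h]
      · intro y hy
        obtain ⟨q, hq⟩ := hconn u hu y (Finset.mem_of_mem_erase hy)
        refine ⟨q, fun z hz => ?_⟩
        by_cases hzu : z = u
        · exact Or.inr hzu
        · exact Or.inl (Finset.mem_erase.2 ⟨hzu, hq z hz⟩)

/-- A graph in which every vertex set of size between `k / 2` and `k` has at least `m` neighbours
contains a cycle of length more than `m`. -/
theorem LocallyExpands.exists_isCycle (hexp : G.LocallyExpands U k m) (hk : 1 ≤ k)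
    (hm : 2 ≤ m) (hU : k ≤ U.card) (hcl : ∀ x ∈ U, ∀ y, G.Adj x y → y ∈ U) :
    ∃ (u : V) (c : G.Walk u u), c.IsCycle ∧ m + 1 ≤ c.length := by
  classical
  obtain ⟨W, hWC, hkW, hWcl, hW⟩ := G.exists_closed_small_or_connected hU
  rcases hW with hW | ⟨hW, hconn⟩
  · have hb := hexp W hWC hkW hW
    obtain ⟨y, hy⟩ := Finset.card_pos.1 (show 0 < _ by exact lt_of_lt_of_le (by omega) hb)
    simp only [Finset.mem_filter, Finset.mem_univ, true_and] at hy
    obtain ⟨hyW, w, hw, h⟩ := hy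
    exact absurd (hWcl w hw y (hcl w (hWC hw) y h) h) hyW
  · obtain ⟨u, hu⟩ : W.Nonempty := Finset.card_pos.1 (by omega)
    have hcard := Finset.card_erase_of_mem hu
    refine hexp.exists_isCycle_of_path hk hm (Walk.nil : G.Walk u u) (by simp) (W.erase u)
      ((W.erase_subset u).trans hWC) (by omega) ?_ ?_ ?_
    · intro y hy
      simpa using (Finset.mem_erase.1 hy).1
    · intro y hy z hz
      rw [Finset.mem_erase] at hy ⊢
      by_cases hzu : z = u
      · simp [hzu]
      · exact Or.inl ⟨hzu, hWcl y hy.2 z (hcl y (hWC hy.2) z hz) hz⟩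
    · intro y hy
      obtain ⟨q, hq⟩ := hconn u hu y (Finset.mem_of_mem_erase hy)
      refine ⟨q, fun z hz => ?_⟩
      by_cases hzu : z = u
      · exact Or.inr hzu
      · exact Or.inl (Finset.mem_erase.2 ⟨hzu, hq z hz⟩)

end Expansion

/-! ### Edge counts and Kővári–Sós–Turán -/

section PairCount

open Classical in
/-- The number of pairs in `A × B` that are adjacent in `G`. -/
noncomputable def pairCount (G : SimpleGraph V) (A B : Finset V) : ℕ :=
  ∑ a ∈ A, (B.filter (G.Adj a)).card

theorem pairCount_mono_left {A B : Finset V} (C : Finset V) (h : A ⊆ B) :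
    G.pairCount A C ≤ G.pairCount B C :=
  Finset.sum_le_sum_of_subset h

theorem pairCount_univ [Fintype V] : G.pairCount Finset.univ Finset.univ = 2 * G.edgeSet.ncard := by
  classical
  rw [Set.ncard_eq_toFinset_card', ← edgeFinset, ← sum_degrees_eq_twice_card_edges, pairCount]
  refine Finset.sum_congr rfl fun v _ => ?_
  rw [← card_neighborFinset_eq_degree]
  congr 1
  ext w
  simp

open Classical in
theorem pairCount_insert {A : Finset V} {v : V} (hv : v ∉ A) :
    G.pairCount (insert v A) (insert v A) = G.pairCount A A + 2 * (A.filter (G.Adj v)).card := by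
  rw [pairCount, Finset.sum_insert hv, pairCount, Finset.filter_insert, if_neg (G.irrefl),
    two_mul, ← add_assoc, add_comm]
  congr 1
  rw [Finset.card_filter (G.Adj v), ← Finset.sum_add_distrib]
  refine Finset.sum_congr rfl fun a ha => ?_
  rw [Finset.filter_insert]
  by_cases h : G.Adj a v
  · rw [if_pos h, if_pos h.symm, Finset.card_insert_of_notMem]
    simp [hv]
  · rw [if_neg h, if_neg fun h' => h h'.symm, add_zero]

open Classical in
/-- A graph with many edges has an induced subgraph with many edges and large minimum degree. -/
theorem exists_minDegree_subset [Fintype V] (G : SimpleGraph V) (y : ℝ) :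
    ∃ U : Finset V, (∀ v ∈ U, y ≤ (U.filter (G.Adj v)).card) ∧
      (G.pairCount Finset.univ Finset.univ : ℝ) - 2 * y * Fintype.card V ≤
        G.pairCount U U - 2 * y * U.card := by
  -- Deleting a vertex of degree below `y` would increase this functional.
  obtain ⟨U, -, hU⟩ := (Finset.univ : Finset (Finset V)).exists_max_image
    (fun U => (G.pairCount U U : ℝ) - 2 * y * U.card) ⟨∅, Finset.mem_univ _⟩
  refine ⟨U, fun v hv => ?_, by simpa using hU Finset.univ (Finset.mem_univ _)⟩
  have h1 := hU (U.erase v) (Finset.mem_univ _)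
  have h2 := pairCount_insert (G := G) (Finset.notMem_erase v U)
  have h3 := Finset.card_erase_add_one hv
  have h4 : (U.erase v).filter (G.Adj v) = U.filter (G.Adj v) := by
    ext w
    simp only [Finset.mem_filter, Finset.mem_erase]
    exact ⟨fun h => ⟨h.1.2, h.2⟩, fun h => ⟨⟨h.2.ne', h.1⟩, h.2⟩⟩
  rw [Finset.insert_erase hv, h4] at h2
  rw [h2, ← h3] at h1
  push_cast at h1
  linarith

-- Double counting of stars: a vertex with an `s`-tuple of its neighbours, repetitions allowed.
open Classical in
theorem sum_card_filter_adj_pow (G : SimpleGraph V) (M : Finset V) (s : ℕ) :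
    ∑ v ∈ M, (M.filter (G.Adj v)).card ^ s =
      ∑ f ∈ Fintype.piFinset fun _ : Fin s => M, (M.filter fun v => ∀ i, G.Adj v (f i)).card := by
  have : ∀ v, (M.filter (G.Adj v)).card ^ s =
      ((Fintype.piFinset fun _ : Fin s => M).filter fun f => ∀ i, G.Adj v (f i)).card := by
    intro v
    rw [← Fintype.card_fin s, ← Fintype.card_piFinset_const, Fintype.card_fin s]
    congr 1
    ext f
    simp only [Fintype.mem_piFinset, Finset.mem_filter]
    exact forall_and
  simp_rw [this, Finset.card_filter]
  exact Finset.sum_comm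

-- For each of the `(r + 1) ^ 2` choices of colliding indices `(i, j)`, the tuple is determined by
-- its entries off `j`.
open Classical in
theorem card_filter_not_injective_le (M : Finset V) (r : ℕ) :
    ((Fintype.piFinset fun _ : Fin (r + 1) => M).filter fun f => ¬ Function.Injective f).card ≤
      (r + 1) ^ 2 * M.card ^ r := by
  set P := Fintype.piFinset fun _ : Fin (r + 1) => M
  have hsub : (P.filter fun f => ¬ Function.Injective f) ⊆
      (Finset.univ : Finset (Fin (r + 1) × Fin (r + 1))).biUnion fun ij =>
        P.filter fun f => ij.1 ≠ ij.2 ∧ f ij.1 = f ij.2 := by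
    intro f hf
    rw [Finset.mem_filter] at hf
    obtain ⟨hfP, hf⟩ := hf
    simp only [Function.Injective, not_forall] at hf
    obtain ⟨i, j, h, hij⟩ := hf
    exact Finset.mem_biUnion.2 ⟨(i, j), Finset.mem_univ _, Finset.mem_filter.2 ⟨hfP, hij, h⟩⟩
  refine (Finset.card_le_card hsub).trans ((Finset.card_biUnion_le_card_mul _ _ (M.card ^ r) ?_).trans
    (by simp [sq]))
  rintro ⟨i, j⟩ -
  have hc : (Fintype.piFinset fun _ : {x : Fin (r + 1) // x ≠ j} => M).card = M.card ^ r := by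
    rw [Fintype.card_piFinset]
    simp
  rw [← hc]
  refine Finset.card_le_card_of_injOn (fun f x => f x) ?_ ?_
  · intro f hf
    simp only [Finset.coe_filter, Set.mem_ofPred_eq, P, Fintype.mem_piFinset] at hf
    exact Fintype.mem_piFinset.2 fun x => hf.1 x
  · intro f hf g hg hfg
    simp only [Finset.coe_filter, Set.mem_ofPred_eq] at hf hg
    have hx : ∀ x, x ≠ j → f x = g x := fun x hx => congrFun hfg ⟨x, hx⟩
    funext x
    by_cases h : x = j
    · rw [h, ← hf.2.2, ← hg.2.2]
      exact hx i hf.2.1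
    · exact hx x h

/-- A form of the Kővári–Sós–Turán theorem. -/
theorem pairCount_pow_le {r t : ℕ}
    (hG : (completeBipartiteGraph (Fin (r + 1)) (Fin t)).Free G) (M : Finset V) :
    (G.pairCount M M : ℝ) ^ (r + 1) ≤ (t + (r + 1) ^ 2) * (M.card : ℝ) ^ (2 * r + 1) := by
  classical
  have hcodeg : ∀ f : Fin (r + 1) → V, Function.Injective f →
      (M.filter fun v => ∀ i, G.Adj v (f i)).card ≤ t := by
    intro f hf
    by_contra! hlt
    obtain ⟨R, hR, hRc⟩ := Finset.exists_subset_card_eq hlt.le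
    refine hG (completeBipartiteGraph_isContained_iff.2
      ⟨Finset.univ.map ⟨f, hf⟩, R, by simp, by simpa using hRc, ?_⟩)
    intro x hx y hy
    obtain ⟨i, -, rfl⟩ := Finset.mem_map.1 hx
    exact ((Finset.mem_filter.1 (hR hy)).2 i).symm
  have hsum : ∑ v ∈ M, (M.filter (G.Adj v)).card ^ (r + 1) ≤
      (t + (r + 1) ^ 2) * M.card ^ (r + 1) := by
    rw [sum_card_filter_adj_pow,
      ← Finset.sum_filter_add_sum_filter_not _ fun f : Fin (r + 1) → V => Function.Injective f,
      add_mul]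
    refine add_le_add ?_ ?_
    · refine (Finset.sum_le_card_nsmul _ _ t fun f hf => hcodeg f (Finset.mem_filter.1 hf).2).trans ?_
      rw [smul_eq_mul, mul_comm]
      refine Nat.mul_le_mul_left _ ((Finset.card_filter_le _ _).trans ?_)
      simp
    · refine (Finset.sum_le_card_nsmul _ _ M.card fun f _ => Finset.card_filter_le _ _).trans ?_
      rw [smul_eq_mul, pow_succ M.card, ← mul_assoc]
      exact Nat.mul_le_mul_right _ (card_filter_not_injective_le M r)
  rcases M.eq_empty_or_nonempty with rfl | hM
  · simp [pairCount]
  have hpos : (0 : ℝ) < M.card := by exact_mod_cast hM.card_pos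
  have hmean := pow_sum_div_card_le_sum_pow (s := M)
    (f := fun v => ((M.filter (G.Adj v)).card : ℝ)) (fun _ _ => by positivity) r
  rw [div_le_iff₀ (by positivity)] at hmean
  rw [pairCount, Nat.cast_sum]
  refine hmean.trans ?_
  have hsum' : ∑ v ∈ M, ((M.filter (G.Adj v)).card : ℝ) ^ (r + 1) ≤
      (t + (r + 1) ^ 2) * (M.card : ℝ) ^ (r + 1) := by exact_mod_cast hsum
  refine (mul_le_mul_of_nonneg_right hsum' (by positivity)).trans (le_of_eq ?_)
  ring

/-- In a `K_{s,t}`-free graph, sets of size at most `γ ^ 2 * n` span few edges. -/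
theorem pairCount_le_of_card_le {s t : ℕ} (hs : 2 ≤ s)
    (hG : (completeBipartiteGraph (Fin s) (Fin t)).Free G) {M : Finset V} {T γ n X : ℝ}
    (hT : (t : ℝ) + s ^ 2 ≤ T) (hγ : 0 < γ) (hγ1 : γ ≤ 1) (hn : 0 ≤ n) (hX : 0 ≤ X)
    (hXs : X ^ s = n ^ (s - 1)) (hM : (M.card : ℝ) ≤ γ ^ 2 * n) :
    (G.pairCount M M : ℝ) ≤ T * γ ^ 3 * (n * X) := by
  obtain ⟨r, rfl⟩ : ∃ r, s = r + 1 := ⟨s - 1, by omega⟩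
  have hT1 : 1 ≤ T := by
    have : (1 : ℝ) ≤ ((r + 1 : ℕ) : ℝ) ^ 2 := one_le_pow₀ (by simp)
    have : (0 : ℝ) ≤ t := by positivity
    linarith
  rw [Nat.add_sub_cancel] at hXs
  rw [← pow_le_pow_iff_left₀ (by positivity) (by positivity) (Nat.succ_ne_zero r)]
  calc (G.pairCount M M : ℝ) ^ (r + 1)
      ≤ (t + (r + 1) ^ 2) * (M.card : ℝ) ^ (2 * r + 1) := pairCount_pow_le hG M
    _ ≤ T * (γ ^ 2 * n) ^ (2 * r + 1) := by
        push_cast at hT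
        gcongr
    _ = T * γ ^ (4 * r + 2) * n ^ (2 * r + 1) := by ring
    _ ≤ T ^ (r + 1) * γ ^ (3 * r + 3) * n ^ (2 * r + 1) := by
        have h1 : T ≤ T ^ (r + 1) := le_self_pow₀ hT1 (Nat.succ_ne_zero r)
        -- This needs `r ≥ 1`, that is `s ≥ 2`. It yields the factor `γ ^ 3` for every `s`.
        have h2 : γ ^ (4 * r + 2) ≤ γ ^ (3 * r + 3) :=
          pow_le_pow_of_le_one hγ.le hγ1 (by omega)
        gcongr
    _ = (T * γ ^ 3 * (n * X)) ^ (r + 1) := by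
        rw [mul_pow, mul_pow, mul_pow, hXs]
        ring

end PairCount

/-! ### Union bound in the random subgraph -/

/-- The probability that a random subset avoids a given finite set. -/
theorem _root_.ProbabilityTheory.setBernoulli_real_disjoint {ι : Type*} {u : Set ι}
    (p : unitInterval) (F : Finset ι) (hF : (F : Set ι) ⊆ u) :
    (setBernoulli u p).real {s | ∀ i ∈ F, i ∉ s} = (1 - p : ℝ) ^ F.card := by
  have h : (fun q : ι → Prop => {i | q i}) ⁻¹' {s | ∀ i ∈ F, i ∉ s} =
      Set.pi F fun _ => {False} := by
    ext q
    simp [Set.mem_pi]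
  rw [measureReal_def, setBernoulli_apply', h, Measure.infinitePi_pi _ fun _ _ => .of_discrete]
  rw [Finset.prod_congr rfl (g := fun _ => (unitInterval.toNNReal (unitInterval.symm p) : ENNReal))]
  · simp
  · intro i hi
    have : i ∈ u := hF hi
    simp [this]

theorem percolation_real_avoid_le [Countable V] (p : unitInterval) (F : Finset (Sym2 V))
    (hF : (F : Set (Sym2 V)) ⊆ G.edgeSet) :
    (G.percolation p).real {H | ∀ e ∈ F, e ∉ H.edgeSet} ≤ (1 - p : ℝ) ^ F.card := by
  rw [← setBernoulli_real_disjoint p F hF, percolation, measureReal_def,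
    measurableEmbedding_edgeSet.comap_apply, ← measureReal_def]
  refine measureReal_mono ?_
  rintro _ ⟨H, hH, rfl⟩
  exact hH

/-- The probability that no edge between two disjoint sets is retained. -/
theorem percolation_real_no_edge_between_le [Countable V] (p : unitInterval)
    {A B : Finset V} (hAB : Disjoint A B) {x : ℝ} (hx : x ≤ G.pairCount A B) :
    (G.percolation p).real {H | ∀ a ∈ A, ∀ b ∈ B, ¬ H.Adj a b} ≤ Real.exp (-(p * x)) := by
  classical
  set F : Finset (Sym2 V) :=
    ((A ×ˢ B).filter fun ab => G.Adj ab.1 ab.2).image fun ab => s(ab.1, ab.2) with hF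
  have hcard : F.card = G.pairCount A B := by
    rw [hF, Finset.card_image_of_injOn, pairCount]
    · rw [Finset.card_filter, Finset.sum_product]
      simp_rw [Finset.card_filter]
    · rintro ⟨a, b⟩ hab ⟨c, d⟩ hcd h
      simp only [Finset.coe_filter, Finset.mem_product, Set.mem_ofPred_eq] at hab hcd
      rcases Sym2.eq_iff.1 h with ⟨rfl, rfl⟩ | ⟨rfl, rfl⟩
      · rfl
      · exact absurd hcd.1.2 (Finset.disjoint_left.1 hAB hab.1.1)
  have hFG : (F : Set (Sym2 V)) ⊆ G.edgeSet := by
    intro e he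
    obtain ⟨ab, hab, rfl⟩ := Finset.mem_image.1 he
    exact (Finset.mem_filter.1 hab).2
  have hp0 : (0 : ℝ) ≤ p := p.2.1
  have hp1 : (0 : ℝ) ≤ 1 - p := sub_nonneg.2 p.2.2
  calc (G.percolation p).real {H | ∀ a ∈ A, ∀ b ∈ B, ¬ H.Adj a b}
      ≤ (G.percolation p).real {H | ∀ e ∈ F, e ∉ H.edgeSet} := by
        refine measureReal_mono fun H hH e he => ?_
        obtain ⟨ab, hab, rfl⟩ := Finset.mem_image.1 he
        rw [Finset.mem_filter, Finset.mem_product] at hab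
        exact hH _ hab.1.1 _ hab.1.2
    _ ≤ (1 - p : ℝ) ^ F.card := percolation_real_avoid_le p F hFG
    _ ≤ Real.exp (-p) ^ F.card := by
        gcongr
        have := Real.add_one_le_exp (-(p : ℝ))
        linarith
    _ = Real.exp (-(p * F.card)) := by
        rw [← Real.exp_nat_mul]
        ring_nf
    _ ≤ Real.exp (-(p * x)) := by
        rw [hcard]
        gcongr

open Classical in
theorem pairCount_add_pairCount_sdiff [DecidableEq V] (A : Finset V) {M U : Finset V} (h : M ⊆ U) :
    G.pairCount A M + G.pairCount A (U \ M) = G.pairCount A U := by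
  rw [pairCount, pairCount, pairCount, ← Finset.sum_add_distrib]
  refine Finset.sum_congr rfl fun a _ => ?_
  rw [← Finset.card_union_of_disjoint
    (Finset.disjoint_filter_filter Finset.disjoint_sdiff), ← Finset.filter_union,
    Finset.union_sdiff_of_subset h]

open Classical in
/-- If `H` has edges leaving every moderately large set and its would-be neighbourhood inside `U`,
then `H` has a long cycle. -/
theorem hasCycle_of_edges_between [Fintype V] [DecidableEq V] {H : SimpleGraph V} {U : Finset V} {k m : ℕ}
    (hk : 1 ≤ k) (hm : 2 ≤ m) (hkU : k ≤ U.card)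
    (h : ∀ W M : Finset V, W ⊆ M → M ⊆ U → k ≤ 2 * W.card → M.card < k + m →
      ∃ a ∈ W, ∃ b ∈ U \ M, H.Adj a b) :
    H.HasCycleOfLengthAtLeast (m + 1 : ℕ) := by
  -- Dropping the edges not inside `U` makes `U` closed under adjacency.
  set H' : SimpleGraph V := (H.induce (U : Set V)).spanningCoe with hH'
  have hadj : ∀ a b, H'.Adj a b ↔ a ∈ U ∧ b ∈ U ∧ H.Adj a b := by
    intro a b
    simp [hH', map_adj]
    tauto
  have hexp : H'.LocallyExpands U k m := by
    intro W hWU hkW hWk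
    by_contra! hlt
    set N := Finset.univ.filter fun y => y ∉ W ∧ ∃ w ∈ W, H'.Adj w y with hN
    have hNm : N.card < m := lt_of_eq_of_lt (by congr!) hlt
    -- With `M = W ∪ N`, an edge to `U \ M` gives a neighbour of `W` missing from `N`.
    obtain ⟨a, ha, b, hb, hab⟩ := h W (W ∪ N) Finset.subset_union_left
      (Finset.union_subset hWU fun y hy => by
        obtain ⟨-, -, w, -, hwy⟩ := Finset.mem_filter.1 hy
        exact ((hadj w y).1 hwy).2.1) hkW
      (lt_of_le_of_lt (Finset.card_union_le _ _) (by omega))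
    rw [Finset.mem_sdiff, Finset.mem_union, not_or] at hb
    exact hb.2.2 (Finset.mem_filter.2
      ⟨Finset.mem_univ _, hb.2.1, a, ha, (hadj a b).2 ⟨hWU ha, hb.1, hab⟩⟩)
  obtain ⟨u, c, hc, hl⟩ := hexp.exists_isCycle hk hm hkU fun x _ y hxy => ((hadj x y).1 hxy).2.1
  have hle : H' ≤ H := fun a b hab => ((hadj a b).1 hab).2.2
  refine ⟨u, c.mapLe hle, hc.mapLe hle, ?_⟩
  rw [Walk.length_mapLe]
  exact_mod_cast hl

open Classical in
/-- If many edges of `G` leave every moderately large set and its would-be neighbourhood, then the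
random subgraph has a long cycle with the complementary probability of a union bound. -/
theorem le_percolation_real_hasCycle [Fintype V] [DecidableEq V] (p : unitInterval) {U : Finset V} {k m : ℕ} {x : ℝ}
    (hk : 1 ≤ k) (hm : 2 ≤ m) (hkU : k ≤ U.card)
    (h : ∀ W M : Finset V, W ⊆ M → M ⊆ U → k ≤ 2 * W.card → M.card < k + m →
      x ≤ G.pairCount W (U \ M)) :
    1 - 4 ^ Fintype.card V * Real.exp (-(p * x)) ≤
      (G.percolation p).real {H | H.HasCycleOfLengthAtLeast (m + 1 : ℕ)} := by
  set A : Set (SimpleGraph V) := {H | H.HasCycleOfLengthAtLeast (m + 1 : ℕ)} with hA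
  set I : Finset (Finset V × Finset V) := Finset.univ.filter fun q =>
    q.1 ⊆ q.2 ∧ q.2 ⊆ U ∧ k ≤ 2 * q.1.card ∧ q.2.card < k + m with hI
  set B : Set (SimpleGraph V) := ⋃ q ∈ I, {H | ∀ a ∈ q.1, ∀ b ∈ U \ q.2, ¬ H.Adj a b} with hB
  have hAB : Set.univ ⊆ A ∪ B := by
    intro H _
    by_contra hcon
    rw [Set.mem_union, not_or] at hcon
    refine hcon.1 (hasCycle_of_edges_between hk hm hkU fun W M hWM hMU hkW hM => ?_)
    by_contra hno
    refine hcon.2 (Set.mem_biUnion (x := (W, M)) ?_ ?_)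
    · exact Finset.mem_filter.2 ⟨Finset.mem_univ _, hWM, hMU, hkW, hM⟩
    · exact fun a ha b hb hab => hno ⟨a, ha, b, hb, hab⟩
  have h1 : (1 : ℝ) ≤ (G.percolation p).real A + (G.percolation p).real B := by
    rw [← probReal_univ (μ := G.percolation p)]
    exact (measureReal_mono hAB).trans (measureReal_union_le _ _)
  have h2 : (G.percolation p).real B ≤ 4 ^ Fintype.card V * Real.exp (-(p * x)) := by
    calc (G.percolation p).real B
        ≤ ∑ q ∈ I, (G.percolation p).real {H | ∀ a ∈ q.1, ∀ b ∈ U \ q.2, ¬ H.Adj a b} :=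
          measureReal_biUnion_finset_le _ _
      _ ≤ I.card • Real.exp (-(p * x)) := by
          refine Finset.sum_le_card_nsmul _ _ _ fun q hq => ?_
          obtain ⟨-, h1, h2, h3, h4⟩ := Finset.mem_filter.1 hq
          exact percolation_real_no_edge_between_le p
            (Finset.disjoint_sdiff.mono_left h1) (h _ _ h1 h2 h3 h4)
      _ ≤ 4 ^ Fintype.card V * Real.exp (-(p * x)) := by
          rw [nsmul_eq_mul]
          refine mul_le_mul_of_nonneg_right ?_ (Real.exp_pos _).le
          have hc : I.card ≤ 4 ^ Fintype.card V := by
            refine (Finset.card_le_univ _).trans (le_of_eq ?_)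
            rw [Fintype.card_prod, Fintype.card_finset, ← mul_pow]
            norm_num
          exact_mod_cast hc
  linarith

theorem four_pow_mul_exp_le {η : ℝ} (hη : 0 < η) {n : ℕ} (hn : 1 / η ≤ n) {z : ℝ}
    (hz : 3 * n ≤ z) : 4 ^ n * Real.exp (-z) ≤ η := by
  have h4 : (4 : ℝ) ≤ Real.exp 2 := by
    have h1 : (2 : ℝ) ≤ Real.exp 1 := by
      have := Real.add_one_le_exp (1 : ℝ)
      linarith
    have h2 : Real.exp 2 = Real.exp 1 * Real.exp 1 := by
      rw [← Real.exp_add]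
      norm_num
    rw [h2]
    nlinarith
  calc (4 : ℝ) ^ n * Real.exp (-z) ≤ Real.exp 2 ^ n * Real.exp (-(3 * n)) := by gcongr
    _ = Real.exp (-n) := by
        rw [← Real.exp_nat_mul, ← Real.exp_add]
        ring_nf
    _ ≤ η := by
        rw [Real.exp_neg]
        refine inv_le_of_inv_le₀ hη ?_
        rw [← one_div]
        have := Real.add_one_le_exp (n : ℝ)
        linarith

/-! ### Edges leaving linear-sized sets, and the choice of constants -/

/-- Every `K_{s,t}`-free graph with at least `α * n * X` edges, where `X ^ s = n ^ (s - 1)`, has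
a vertex set `U` such that many edges go from moderately large sets to the rest of `U`. -/
theorem exists_subset_many_edges_leaving {n s t k : ℕ} {G : SimpleGraph (Fin n)} {α γ T X : ℝ}
    (hα : 0 < α) (hs : 2 ≤ s) (hG : (completeBipartiteGraph (Fin s) (Fin t)).Free G)
    (hT : (t : ℝ) + s ^ 2 ≤ T) (hγ : 0 < γ) (hγ1 : γ ≤ 1) (hγT : γ * T ≤ α / 32) (hn : 0 < n)
    (hX : 0 < X) (hXs : X ^ s = (n : ℝ) ^ (s - 1)) (hE : α * (n * X) ≤ G.edgeSet.ncard)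
    (hk1 : γ ^ 2 * n / 4 ≤ k) (hk2 : 2 * k ≤ γ ^ 2 * n) :
    ∃ U : Finset (Fin n), k ≤ U.card ∧ ∀ W M : Finset (Fin n), W ⊆ M → M ⊆ U → k ≤ 2 * W.card →
      M.card < k + k → γ ^ 2 * α / 32 * (n * X) ≤ G.pairCount W (U \ M) := by
  classical
  have hn' : (0 : ℝ) < n := by exact_mod_cast hn
  have hsmall : ∀ M : Finset (Fin n), (M.card : ℝ) ≤ γ ^ 2 * n →
      (G.pairCount M M : ℝ) ≤ γ ^ 2 * α / 32 * (n * X) := by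
    intro M hM
    refine (pairCount_le_of_card_le hs hG hT hγ hγ1 hn'.le hX.le hXs hM).trans ?_
    refine mul_le_mul_of_nonneg_right ?_ (by positivity)
    have := mul_le_mul_of_nonneg_left hγT (sq_nonneg γ)
    linarith
  -- This threshold costs at most half of the `2 * α * n * X` ordered pairs, so `U` spans too many
  -- edges to be small.
  obtain ⟨U, hdeg, hU⟩ := G.exists_minDegree_subset (α * X / 2)
  rw [pairCount_univ, Fintype.card_fin] at hU
  push_cast at hU
  refine ⟨U, ?_, fun W M hWM hMU hkW hM => ?_⟩
  · by_contra! hlt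
    have hlt' : (U.card : ℝ) < k := by exact_mod_cast hlt
    have h1 := hsmall U (by linarith)
    have h2 : 0 ≤ 2 * (α * X / 2) * (U.card : ℝ) := by positivity
    have h3 : 0 < α * (n * X) := by positivity
    have h4 : γ ^ 2 * (α * (n * X)) ≤ 1 * (α * (n * X)) :=
      mul_le_mul_of_nonneg_right (pow_le_one₀ hγ.le hγ1) h3.le
    linarith
  · have hM' : (M.card : ℝ) < k + k := by exact_mod_cast hM
    have h1 : (G.pairCount W M : ℝ) ≤ γ ^ 2 * α / 32 * (n * X) :=
      le_trans (by exact_mod_cast pairCount_mono_left M hWM) (hsmall M (by linarith))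
    have h2 : (G.pairCount W M : ℝ) + G.pairCount W (U \ M) = G.pairCount W U := by
      exact_mod_cast pairCount_add_pairCount_sdiff W hMU
    have h3 : (W.card : ℝ) * (α * X / 2) ≤ G.pairCount W U := by
      rw [pairCount, Nat.cast_sum, ← nsmul_eq_mul]
      exact Finset.card_nsmul_le_sum _ _ _ fun v hv => hdeg v (hMU (hWM hv))
    have hkW' : (k : ℝ) ≤ 2 * W.card := by exact_mod_cast hkW
    have h4 : γ ^ 2 * n / 8 * (α * X / 2) ≤ W.card * (α * X / 2) :=
      mul_le_mul_of_nonneg_right (by linarith) (by positivity)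
    linarith

end SimpleGraph

theorem mainTheorem3 (α : ℝ) (hα : 0 < α) (t : ℕ) :
    ∃ K : ℝ, 0 < K ∧ ∃ c : ℝ, 0 < c ∧
      ∀ η : ℝ, 0 < η → ∃ n₀ : ℕ, ∀ n : ℕ, n₀ ≤ n →
        ∀ s : ℕ, 2 ≤ s → s ≤ t →
          ∀ G : SimpleGraph (Fin n),
            (completeBipartiteGraph (Fin s) (Fin t)).Free G →
            α * (n : ℝ) ^ (2 - 1 / (s : ℝ)) ≤ (G.edgeSet.ncard : ℝ) →
            ∀ p : unitInterval, K / (n : ℝ) ^ (1 - 1 / (s : ℝ)) ≤ (p : ℝ) →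
              1 - η ≤ (G.percolation p).real {H | H.HasCycleOfLengthAtLeast (c * (n : ℝ))} := by
  -- `T` dominates `t + s ^ 2` for all `s ≤ t`, so `K` and `c` do not depend on `s`.
  set T : ℝ := t + t ^ 2 + 1 with hT
  have hT0 : 0 < T := by positivity
  set γ : ℝ := min 1 (α / (32 * T)) with hγ
  have hγ0 : 0 < γ := lt_min one_pos (by positivity)
  have hγ1 : γ ≤ 1 := min_le_left _ _
  have hγT : γ * T ≤ α / 32 := by
    have : γ * T ≤ α / (32 * T) * T := mul_le_mul_of_nonneg_right (min_le_right _ _) hT0.le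
    refine this.trans (le_of_eq ?_)
    field_simp
  refine ⟨3 / (γ ^ 2 * α / 32), by positivity, γ ^ 2 / 3, by positivity, fun η hη => ?_⟩
  -- The bound `12 / γ ^ 2` absorbs the floor in `k`, giving `k ≥ γ ^ 2 * n / 4` and `k ≥ 2`.
  refine ⟨max 1 (max ⌈12 / γ ^ 2⌉₊ ⌈1 / η⌉₊), fun n hn s hs hst G hG hE p hp => ?_⟩
  rw [max_le_iff, max_le_iff, Nat.ceil_le, Nat.ceil_le, div_le_iff₀ (by positivity)] at hn
  obtain ⟨hn1, hn2, hn3⟩ := hn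
  have hn0 : (0 : ℝ) < n := by exact_mod_cast hn1
  have hs0 : (0 : ℝ) < s := by exact_mod_cast (by omega : 0 < s)
  set X : ℝ := (n : ℝ) ^ (1 - 1 / (s : ℝ)) with hX
  have hX0 : 0 < X := Real.rpow_pos_of_pos hn0 _
  have hXs : X ^ s = (n : ℝ) ^ (s - 1) := by
    rw [hX, ← Real.rpow_natCast, ← Real.rpow_mul hn0.le, ← Real.rpow_natCast]
    congr 1
    rw [Nat.cast_sub (by omega)]
    field_simp
    simp
  have hnX : (n : ℝ) ^ (2 - 1 / (s : ℝ)) = n * X := by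
    rw [hX, ← Real.rpow_one_add' hn0.le]
    · ring_nf
    · have : 1 / (s : ℝ) ≤ 1 := by
        rw [div_le_one hs0]
        exact_mod_cast (by omega : 1 ≤ s)
      linarith
  rw [hnX] at hE
  set k : ℕ := ⌊γ ^ 2 * n / 3⌋₊ with hk
  have hk1 : (k : ℝ) ≤ γ ^ 2 * n / 3 := Nat.floor_le (by positivity)
  have hk2 : γ ^ 2 * n / 3 < k + 1 := Nat.lt_floor_add_one _
  have hk3 : 2 ≤ k := by
    have : (3 : ℝ) < k + 1 := by linarith
    have : 3 < k + 1 := by exact_mod_cast this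
    omega
  have hst' : (s : ℝ) ^ 2 ≤ t ^ 2 := by gcongr
  obtain ⟨U, hkU, hU⟩ := SimpleGraph.exists_subset_many_edges_leaving (k := k) (T := T) hα hs hG
    (by linarith) hγ0 hγ1 hγT hn1 hX0 hXs hE (by linarith) (by linarith)
  have hmain := SimpleGraph.le_percolation_real_hasCycle p (by omega) hk3 hkU hU
  have hz : 3 * (n : ℝ) ≤ p * (γ ^ 2 * α / 32 * (n * X)) := by
    rw [div_le_iff₀ hX0, div_le_iff₀ (by positivity)] at hp
    nlinarith
  rw [Fintype.card_fin] at hmain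
  have hexp := SimpleGraph.four_pow_mul_exp_le hη hn3 hz
  refine (by linarith : 1 - η ≤ _).trans (hmain.trans (measureReal_mono ?_))
  rintro H ⟨v, w, hw, hl⟩
  refine ⟨v, w, hw, le_trans ?_ hl⟩
  push_cast
  linarith
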